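/- Let $K$ be a field and let $n_1<n_2<n_3<n_4$ be positive integers with $\gcd(n_1,n_2,n_3,n_4)=1$. Let $C$ be the monomial curve $x_1=t^{n_1},\dots,x_4=t^{n_4}$ in $\mathbb{A}^4(K)$, and let $I(C)$ be the kernel of the $K$-algebra homomorphism $K[x_1,\dots,x_4]\to K[t]$, $x_i\mapsto t^{n_i}$. Suppose that $I(C)$ is minimally generated by the five binomials $$x_1^{a_1}-x_3^{a_{13}}x_4^{a_{14}},\quad x_2^{a_2}-x_1^{a_{21}}x_3^{a_{23}},\quad x_3^{a_3}-x_2^{a_{32}}x_4^{a_{34}},\quad x_4^{a_4}-x_1^{a_{41}}x_2^{a_{42}},\quad x_1^{a_{21}}x_4^{a_{34}}-x_2^{a_{42}}x_3^{a_{13}},$$ where $0<a_{ij}<a_j$ for every exponent $a_{ij}$ that occurs. Suppose also that $a_{32}<a_{42}$ and $a_{14}\le a_{34}$. Let $I(C)_*$ be the ideal generated by the homogeneous summands of least degree of the nonzero elements of $I(C)$. Then $C$ has Cohen–Macaulay tangent cone at the origin, that is, the ring $K[x_1,\dots,x_4]/I(C)_*$ is Cohen–Macaulay, if and only if 1. $a_2\le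 a_{21}+a_{23}$, 2. $a_{42}+a_{13}\le a_{21}+a_{34}$, and 3. $a_3+a_{13}\le a_1+a_{32}+a_{34}-a_{14}$. -/

import Mathlib

open MvPolynomial

noncomputable section

namespace MonomialCurve

/-- The depth of a (Noetherian) local ring: the supremum of the lengths of the regular sequences
contained in the maximal ideal. -/
def localDepth (R : Type*) [CommRing R] [IsLocalRing R] : WithBot ℕ∞ :=
  ⨆ rs ∈ {rs : List R | (∀ r ∈ rs, r ∈ IsLocalRing.maximalIdeal R) ∧
    RingTheory.Sequence.IsRegular R rs}, (rs.length : WithBot ℕ∞)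

/-- A Cohen-Macaulay local ring: a Noetherian local ring whose depth is its Krull dimension. -/
def IsCohenMacaulayLocal (R : Type*) [CommRing R] [IsLocalRing R] : Prop :=
  IsNoetherianRing R ∧ localDepth R = ringKrullDim R

/-- A Cohen-Macaulay ring: a Noetherian ring whose localizations at all maximal ideals are
Cohen-Macaulay local rings. -/
def IsCohenMacaulay (R : Type*) [CommRing R] : Prop :=
  IsNoetherianRing R ∧
    ∀ (m : Ideal R) [m.IsMaximal], IsCohenMacaulayLocal (Localization.AtPrime m)

variable (K : Type*) [Field K]

/-- The toric ideal `I(C)` of the monomial curve `x_i = t ^ n_i`: the kernel of the `K`-algebra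
homomorphism `K[x_1, …, x_d] → K[t]`, `x_i ↦ t ^ n_i`. -/
def toricIdeal {d : ℕ} (n : Fin d → ℕ) : Ideal (MvPolynomial (Fin d) K) :=
  RingHom.ker (aeval (fun i => (Polynomial.X : Polynomial K) ^ n i) :
    MvPolynomial (Fin d) K →ₐ[K] Polynomial K)

variable {K}

/-- The ideal of initial forms of `I`, generated by the homogeneous summands of least degree of the
elements of `I` (the summand of degree `k` of `f` is used when all those of lower degree vanish). -/
def initialFormIdeal {d : ℕ} (I : Ideal (MvPolynomial (Fin d) K)) :
    Ideal (MvPolynomial (Fin d) K) :=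
  Ideal.span {g | ∃ f ∈ I, ∃ k : ℕ,
    (∀ j < k, homogeneousComponent j f = 0) ∧ g = homogeneousComponent k f}

variable (K)

/-- The coordinate ring of the tangent cone at the origin of the monomial curve `x_i = t ^ n_i`. -/
abbrev TangentConeRing {d : ℕ} (n : Fin d → ℕ) : Type _ :=
  MvPolynomial (Fin d) K ⧸ initialFormIdeal (toricIdeal K n)

/-- The monomial curve `x_i = t ^ n_i` has Cohen-Macaulay tangent cone at the origin. -/
def HasCohenMacaulayTangentCone {d : ℕ} (n : Fin d → ℕ) : Prop :=
  IsCohenMacaulay (TangentConeRing K n)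

/-- `S` is a minimal generating set of the ideal `I`. -/
def IsMinimalGeneratingSet {R : Type*} [CommRing R] (I : Ideal R) (S : Set R) : Prop :=
  Ideal.span S = I ∧ ∀ T : Set R, T ⊂ S → Ideal.span T ≠ I

/-- The exponents `a_i`, `a_ij` of the five binomials below. -/
structure Exponents where
  (a1 a2 a3 a4 a13 a14 a21 a23 a32 a34 a41 a42 : ℕ)

/-- The five binomials that generate the toric ideal, in the variables `x_1 = X 0, …, x_4 = X 3`. -/
def binomials (e : Exponents) : Set (MvPolynomial (Fin 4) K) :=
  { X 0 ^ e.a1 - X 2 ^ e.a13 * X 3 ^ e.a14,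
    X 1 ^ e.a2 - X 0 ^ e.a21 * X 2 ^ e.a23,
    X 2 ^ e.a3 - X 1 ^ e.a32 * X 3 ^ e.a34,
    X 3 ^ e.a4 - X 0 ^ e.a41 * X 1 ^ e.a42,
    X 0 ^ e.a21 * X 3 ^ e.a34 - X 1 ^ e.a42 * X 2 ^ e.a13 }

/-- The toric ideal of the curve is minimally generated by the five
binomials, where `0 < a_ij < a_j` for each `a_ij` that occurs. -/
structure IsGivenByBinomials (n : Fin 4 → ℕ) (e : Exponents) : Prop where
  minimal : IsMinimalGeneratingSet (toricIdeal K n) (binomials K e)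
  a13 : 0 < e.a13 ∧ e.a13 < e.a3
  a14 : 0 < e.a14 ∧ e.a14 < e.a4
  a21 : 0 < e.a21 ∧ e.a21 < e.a1
  a23 : 0 < e.a23 ∧ e.a23 < e.a3
  a32 : 0 < e.a32 ∧ e.a32 < e.a2
  a34 : 0 < e.a34 ∧ e.a34 < e.a4
  a41 : 0 < e.a41 ∧ e.a41 < e.a1
  a42 : 0 < e.a42 ∧ e.a42 < e.a2

end MonomialCurve

end

/-! Call exponent vectors of equal weight a fibre. A monomial of non-maximal degree in its fibre is
the lowest form of a binomial of `I(C)`, and two monomials of equal weight and degree differ by an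
initial form. So `I(C)_*` is the kernel of the linear map that keeps the monomials of maximal degree
and sends them to powers of `t` (`mem_initialFormIdeal_iff`).

The variables other than `x_1` are nilpotent on the tangent cone, because `n_1` is the strict
minimum. So its dimension is at most one, the local ring at the origin has dimension at least one,
and Cohen–Macaulayness comes down to `x_1` being a nonzerodivisor. On fibres this says that passing
from `u` to `u + e_1` raises the maximal degree by at most one: `DegreeLiftsAlong`
(`hasCohenMacaulayTangentCone_iff`).

For the five binomials, three one-element fibres force the inequalities. Conversely, every monomial
whose fibre meets the multiples of `x_1` is divisible by one of six explicit monomials, and the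
inequalities allow each of these to be traded for a multiple of `x_1` without loss of degree. -/

noncomputable section

namespace MonomialCurve

/-! ### Fibres of the weight and the ideal of initial forms. -/

section Toric

variable {K : Type*} [Field K] {d : ℕ} {n : Fin d → ℕ}

theorem coeff_aeval_X_pow (f : MvPolynomial (Fin d) K) (s : ℕ) :
    (aeval (fun i => (Polynomial.X : Polynomial K) ^ n i) f).coeff s =
      ∑ u ∈ f.support, if Finsupp.weight n u = s then coeff u f else 0 := by
  rw [MvPolynomial.aeval_def, MvPolynomial.eval₂_eq, Polynomial.finsetSum_coeff]
  refine Finset.sum_congr rfl fun u _ => ?_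
  have : ∏ i ∈ u.support, ((Polynomial.X : Polynomial K) ^ n i) ^ u i =
      Polynomial.X ^ Finsupp.weight n u := by
    simp_rw [← pow_mul]
    rw [Finset.prod_pow_eq_pow_sum, Finsupp.weight_apply, Finsupp.sum]
    congr 1
    exact Finset.sum_congr rfl fun i _ => by rw [smul_eq_mul, mul_comm]
  rw [this, Polynomial.algebraMap_eq, Polynomial.coeff_C_mul, Polynomial.coeff_X_pow]
  simp [eq_comm]

theorem aeval_X_pow_monomial (u : Fin d →₀ ℕ) (c : K) :
    aeval (fun i => (Polynomial.X : Polynomial K) ^ n i) (monomial u c) =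
      Polynomial.monomial (Finsupp.weight n u) c := by
  ext s
  classical
  rw [coeff_aeval_X_pow, Polynomial.coeff_monomial]
  by_cases hc : c = 0
  · simp [hc]
  · simp [support_monomial, hc]

theorem monomial_sub_monomial_mem_toricIdeal_iff {u v : Fin d →₀ ℕ} :
    monomial u (1 : K) - monomial v 1 ∈ toricIdeal K n ↔
      Finsupp.weight n u = Finsupp.weight n v := by
  rw [toricIdeal, RingHom.mem_ker, map_sub, aeval_X_pow_monomial, aeval_X_pow_monomial, sub_eq_zero]
  constructor
  · intro h
    exact ((Polynomial.monomial_left_inj one_ne_zero).1 h)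
  · intro h
    rw [h]

/-- A property of exponent vectors preserved by adding the two sides of each binomial of a
generating family of the toric ideal is constant on each fibre of the weight. -/
theorem iff_of_weight_eq {r : (Fin d →₀ ℕ) → (Fin d →₀ ℕ) → Prop}
    (hr : toricIdeal K n ≤ Ideal.span {p | ∃ g h, r g h ∧ p = monomial g (1 : K) - monomial h 1})
    {P : (Fin d →₀ ℕ) → Prop} (hP : ∀ g h w, r g h → (P (w + g) ↔ P (w + h)))
    {u v : Fin d →₀ ℕ} (huv : Finsupp.weight n u = Finsupp.weight n v) : P u ↔ P v := by
  classical
  let ψ : MvPolynomial (Fin d) K →ₗ[K] K :=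
    (basisMonomials (Fin d) K).constr K fun u => if P u then 1 else 0
  have hψ : ∀ u, ψ (monomial u 1) = if P u then 1 else 0 := fun u => by
    simpa only [coe_basisMonomials] using
      (basisMonomials (Fin d) K).constr_basis K (fun u => if P u then (1 : K) else 0) u
  -- The functional `ψ` is linear but not multiplicative, so the induction over the ideal carries an
  -- arbitrary multiplier `p`.
  have key : ∀ f ∈ Ideal.span {p | ∃ g h, r g h ∧ p = monomial g (1 : K) - monomial h 1},
      ∀ p, ψ (p * f) = 0 := by
    intro f hf
    induction hf using Submodule.span_induction with
    | zero => simp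
    | add a b _ _ ha hb => intro p; rw [mul_add, map_add, ha, hb, add_zero]
    | smul a b _ hb => intro p; rw [smul_eq_mul, ← mul_assoc, hb]
    | mem f hf =>
      obtain ⟨g, h, hgh, rfl⟩ := hf
      intro p
      induction p using MvPolynomial.induction_on' with
      | add p q hp hq => rw [add_mul, map_add, hp, hq, add_zero]
      | monomial w c =>
        have : monomial w c * (monomial g (1 : K) - monomial h 1) =
            c • (monomial (w + g) 1 - monomial (w + h) 1) := by
          simp [mul_sub, smul_sub, monomial_mul, smul_monomial]
        rw [this, map_smul, map_sub, hψ, hψ]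
        simp [hP g h w hgh]
  have h0 := key _ (hr (monomial_sub_monomial_mem_toricIdeal_iff.2 huv)) 1
  rw [one_mul, map_sub, hψ, hψ] at h0
  by_cases hu : P u <;> by_cases hv : P v <;> simp_all

/-- An exponent vector of the largest degree in its fibre of the weight. -/
def IsMaxDegree (n : Fin d → ℕ) (u : Fin d →₀ ℕ) : Prop :=
  ∀ w, Finsupp.weight n w = Finsupp.weight n u → w.degree ≤ u.degree

theorem IsMaxDegree.of_eq {u v : Fin d →₀ ℕ} (hu : IsMaxDegree n u)
    (hw : Finsupp.weight n v = Finsupp.weight n u) (hd : v.degree = u.degree) :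
    IsMaxDegree n v :=
  fun w h => (hu w (h.trans hw)).trans hd.ge

open Classical in
variable (K n) in
/-- The linear map that sends a monomial of the largest degree in its fibre to its image on the
curve, and every other monomial to zero. -/
def maxDegreeMap : MvPolynomial (Fin d) K →ₗ[K] Polynomial K :=
  (basisMonomials (Fin d) K).constr K fun u =>
    if IsMaxDegree n u then Polynomial.monomial (Finsupp.weight n u) 1 else 0

open Classical in
theorem maxDegreeMap_monomial (u : Fin d →₀ ℕ) (c : K) :
    maxDegreeMap K n (monomial u c) =
      if IsMaxDegree n u then Polynomial.monomial (Finsupp.weight n u) c else 0 := by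
  have h := (basisMonomials (Fin d) K).constr_basis K (fun u =>
    if IsMaxDegree n u then Polynomial.monomial (Finsupp.weight n u) (1 : K) else 0) u
  rw [coe_basisMonomials] at h
  have hc : monomial u c = c • monomial u (1 : K) := by simp [smul_monomial]
  rw [hc, map_smul, maxDegreeMap, h]
  split_ifs <;> simp [Polynomial.smul_monomial]

open Classical in
theorem coeff_maxDegreeMap (f : MvPolynomial (Fin d) K) (s : ℕ) :
    (maxDegreeMap K n f).coeff s =
      ∑ u ∈ f.support, if IsMaxDegree n u ∧ Finsupp.weight n u = s then coeff u f else 0 := by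
  conv_lhs => rw [f.as_sum, map_sum, Polynomial.finsetSum_coeff]
  refine Finset.sum_congr rfl fun u _ => ?_
  rw [maxDegreeMap_monomial]
  by_cases h : IsMaxDegree n u <;> simp [h, Polynomial.coeff_monomial]

/-- Positive weights bound the degree by the weight, so every fibre is finite. -/
theorem exists_isMaxDegree (hn : ∀ i, 0 < n i) (u : Fin d →₀ ℕ) :
    ∃ w, Finsupp.weight n w = Finsupp.weight n u ∧ u.degree ≤ w.degree ∧ IsMaxDegree n w := by
  have hle : ∀ w : Fin d →₀ ℕ, w.degree ≤ Finsupp.weight n w := by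
    intro w
    rw [Finsupp.degree_eq_sum, Finsupp.weight_eq_sum]
    exact Finset.sum_le_sum fun i _ => Nat.le_mul_of_pos_right _ (hn i)
  have hfin : {w : Fin d →₀ ℕ | Finsupp.weight n w = Finsupp.weight n u}.Finite :=
    (Finsupp.finite_of_degree_le (Finsupp.weight n u)).subset fun w hw => by
      have := hle w
      rw [Set.mem_ofPred_eq] at hw ⊢
      omega
  obtain ⟨w, hw, hmax⟩ := hfin.exists_maximalFor Finsupp.degree _ ⟨u, rfl⟩
  have hm : IsMaxDegree n w := fun v hv => by
    by_contra hlt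
    exact hlt (hmax (hv.trans hw) (by omega))
  exact ⟨w, hw, hm u hw.symm, hm⟩

/-- If the maximal degree in the fibre of weight `s` is `k`, then `f` has no terms of that fibre
outside degree `k`: lower ones vanish by hypothesis, higher ones do not exist. The coefficient at
`s` is then that of the image of `f` on the curve, which is zero. For any other `k` no monomial
contributes. -/
theorem maxDegreeMap_homogeneousComponent {f : MvPolynomial (Fin d) K} (hf : f ∈ toricIdeal K n)
    {k : ℕ} (hk : ∀ j < k, homogeneousComponent j f = 0) :
    maxDegreeMap K n (homogeneousComponent k f) = 0 := by
  classical
  ext s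
  rw [Polynomial.coeff_zero]
  have hlow : ∀ u : Fin d →₀ ℕ, u.degree < k → coeff u f = 0 := by
    intro u hu
    have := congrArg (coeff u) (hk _ hu)
    simpa [coeff_homogeneousComponent] using this
  by_cases hs : ∃ m : Fin d →₀ ℕ, IsMaxDegree n m ∧ Finsupp.weight n m = s ∧ m.degree = k
  · obtain ⟨m, hm, rfl, rfl⟩ := hs
    have h0 : (aeval (fun i => (Polynomial.X : Polynomial K) ^ n i) f).coeff
        (Finsupp.weight n m) = 0 := by
      rw [show aeval (fun i => (Polynomial.X : Polynomial K) ^ n i) f = 0 from hf,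
        Polynomial.coeff_zero]
    rw [coeff_aeval_X_pow] at h0
    rw [coeff_maxDegreeMap]
    refine Eq.trans ?_ h0
    have hsub : (homogeneousComponent m.degree f).support ⊆ f.support := by
      intro u hu
      rw [mem_support_iff, coeff_homogeneousComponent] at hu
      rw [mem_support_iff]
      exact fun h => hu (by simp [h])
    rw [← Finset.sum_subset hsub]
    · refine Finset.sum_congr rfl fun u hu => ?_
      rw [mem_support_iff, coeff_homogeneousComponent] at hu
      have hd : u.degree = m.degree := by
        by_contra h
        exact hu (if_neg h)
      rw [coeff_homogeneousComponent, if_pos hd]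
      congr 1
      exact propext ⟨fun h => h.2, fun h => ⟨hm.of_eq h hd, h⟩⟩
    · intro u hu hu'
      rw [notMem_support_iff, coeff_homogeneousComponent] at hu'
      rw [mem_support_iff] at hu
      refine if_neg fun hw => ?_
      rcases (hm u hw).lt_or_eq with h | h
      · exact hu (hlow u h)
      · exact hu (by simpa [h] using hu')
  · rw [coeff_maxDegreeMap]
    refine Finset.sum_eq_zero fun u _ => ?_
    rw [coeff_homogeneousComponent]
    split_ifs with h1 h2
    · exact absurd ⟨u, h1.1, h1.2, h2⟩ hs
    · rfl
    · rfl

theorem homogeneousComponent_monomial (k : ℕ) (v : Fin d →₀ ℕ) (a : K) :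
    homogeneousComponent k (monomial v a) = if v.degree = k then monomial v a else 0 := by
  classical
  ext x
  rw [coeff_homogeneousComponent]
  by_cases hx : v = x
  · subst hx
    split_ifs <;> simp
  · split_ifs <;> simp [coeff_monomial, hx]

theorem homogeneousComponent_monomial_mul (w : Fin d →₀ ℕ) (c : K) (f : MvPolynomial (Fin d) K)
    (j : ℕ) : homogeneousComponent j (monomial w c * f) =
      if w.degree ≤ j then monomial w c * homogeneousComponent (j - w.degree) f else 0 := by
  classical
  induction f using MvPolynomial.induction_on' with
  | add p q hp hq => simp only [mul_add, map_add, hp, hq]; split_ifs <;> simp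
  | monomial u b =>
    simp only [monomial_mul, homogeneousComponent_monomial, map_add]
    by_cases h : w.degree ≤ j
    · by_cases h' : u.degree = j - w.degree
      · rw [if_pos (by omega), if_pos h, if_pos h', monomial_mul]
      · rw [if_neg (by omega), if_pos h, if_neg h', mul_zero]
    · rw [if_neg (by omega), if_neg h]

theorem maxDegreeMap_eq_zero {f : MvPolynomial (Fin d) K}
    (hf : f ∈ initialFormIdeal (toricIdeal K n)) : maxDegreeMap K n f = 0 := by
  suffices h : ∀ p, maxDegreeMap K n (p * f) = 0 by simpa using h 1
  induction hf using Submodule.span_induction with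
  | zero => simp
  | add a b _ _ ha hb => intro p; rw [mul_add, map_add, ha, hb, add_zero]
  | smul a b _ hb => intro p; rw [smul_eq_mul, ← mul_assoc, hb]
  | mem g hg =>
    obtain ⟨f, hf, k, hk, rfl⟩ := hg
    intro p
    induction p using MvPolynomial.induction_on' with
    | add p q hp hq => rw [add_mul, map_add, hp, hq, add_zero]
    | monomial w c =>
      -- A monomial times an initial form is again an initial form of an element of the ideal, in
      -- degree shifted by `w.degree`.
      have := maxDegreeMap_homogeneousComponent (k := k + w.degree)
        (Ideal.mul_mem_left _ (monomial w c) hf) fun j hj => by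
          rw [homogeneousComponent_monomial_mul]
          split_ifs with h
          · rw [hk _ (by omega), mul_zero]
          · rfl
      rwa [homogeneousComponent_monomial_mul, if_pos (by omega), Nat.add_sub_cancel] at this

theorem mem_initialFormIdeal_of_weight_eq {w v : Fin d →₀ ℕ}
    (hw : Finsupp.weight n w = Finsupp.weight n v) (hd : w.degree < v.degree) :
    monomial w (1 : K) ∈ initialFormIdeal (toricIdeal K n) := by
  refine Ideal.subset_span ⟨monomial w 1 - monomial v 1,
    monomial_sub_monomial_mem_toricIdeal_iff.2 hw, w.degree, fun j hj => ?_, ?_⟩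
  · rw [map_sub, homogeneousComponent_monomial, homogeneousComponent_monomial,
      if_neg (by omega), if_neg (by omega), sub_zero]
  · rw [map_sub, homogeneousComponent_monomial, homogeneousComponent_monomial,
      if_pos rfl, if_neg (by omega), sub_zero]

theorem sub_mem_initialFormIdeal_of_weight_eq {w v : Fin d →₀ ℕ}
    (hw : Finsupp.weight n w = Finsupp.weight n v) (hd : w.degree = v.degree) :
    monomial w (1 : K) - monomial v 1 ∈ initialFormIdeal (toricIdeal K n) := by
  refine Ideal.subset_span ⟨monomial w 1 - monomial v 1,
    monomial_sub_monomial_mem_toricIdeal_iff.2 hw, w.degree, fun j hj => ?_, ?_⟩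
  · rw [map_sub, homogeneousComponent_monomial, homogeneousComponent_monomial,
      if_neg (by omega), if_neg (by omega), sub_zero]
  · rw [map_sub, homogeneousComponent_monomial, homogeneousComponent_monomial,
      if_pos rfl, if_pos hd.symm]

/-- The ideal of initial forms of the toric ideal is the kernel of `maxDegreeMap`. -/
theorem mem_initialFormIdeal_iff {f : MvPolynomial (Fin d) K} :
    f ∈ initialFormIdeal (toricIdeal K n) ↔ maxDegreeMap K n f = 0 := by
  classical
  refine ⟨maxDegreeMap_eq_zero, fun h => ?_⟩
  -- A partial inverse `t ^ s ↦` class of a maximal-degree monomial of weight `s`; the value `0` is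
  -- taken when no monomial has weight `s`. Composed with `maxDegreeMap` it gives the quotient map.
  let rep : ℕ → TangentConeRing K n := fun s =>
    if h : ∃ w : Fin d →₀ ℕ, Finsupp.weight n w = s ∧ IsMaxDegree n w then
      Ideal.Quotient.mk _ (monomial h.choose 1) else 0
  let σ : Polynomial K →ₗ[K] TangentConeRing K n := (Polynomial.basisMonomials K).constr K rep
  have hσ : ∀ s, σ (Polynomial.monomial s 1) = rep s := fun s => by
    simpa only [Polynomial.coe_basisMonomials] using
      (Polynomial.basisMonomials K).constr_basis K rep s
  have key : ∀ f, σ (maxDegreeMap K n f) = Ideal.Quotient.mkₐ K _ f := by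
    refine LinearMap.congr_fun (f := σ ∘ₗ maxDegreeMap K n) (g := (Ideal.Quotient.mkₐ K
      (initialFormIdeal (toricIdeal K n))).toLinearMap) ((basisMonomials (Fin d) K).ext fun u => ?_)
    simp only [coe_basisMonomials, LinearMap.comp_apply, AlgHom.toLinearMap_apply,
      Ideal.Quotient.mkₐ_eq_mk]
    rw [maxDegreeMap_monomial]
    by_cases hu : IsMaxDegree n u
    · have hex : ∃ w : Fin d →₀ ℕ, Finsupp.weight n w = Finsupp.weight n u ∧ IsMaxDegree n w :=
        ⟨u, rfl, hu⟩
      rw [if_pos hu, hσ]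
      simp only [rep, dif_pos hex]
      obtain ⟨h1, h2⟩ := hex.choose_spec
      exact Ideal.Quotient.eq.2 (sub_mem_initialFormIdeal_of_weight_eq h1
        ((hu _ h1).antisymm (h2 _ h1.symm)))
    · rw [if_neg hu, map_zero, eq_comm, Ideal.Quotient.eq_zero_iff_mem]
      rw [IsMaxDegree] at hu
      push Not at hu
      obtain ⟨w, hw, hd⟩ := hu
      exact mem_initialFormIdeal_of_weight_eq hw.symm hd
  have := key f
  rw [h, map_zero, Ideal.Quotient.mkₐ_eq_mk] at this
  exact Ideal.Quotient.eq_zero_iff_mem.1 this.symm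

/-! ### Lifting of degrees as regularity of a variable. -/

theorem weight_single_one (i : Fin d) : Finsupp.weight n (Finsupp.single i 1) = n i := by
  rw [Finsupp.weight_single, one_smul]

variable (n) in
/-- Every element of the fibre of `u + e_i` has degree at most one more than some element of the
fibre of `u`. -/
def DegreeLiftsAlong (i : Fin d) : Prop :=
  ∀ u v : Fin d →₀ ℕ, Finsupp.weight n v = Finsupp.weight n u + n i →
    ∃ w, Finsupp.weight n w = Finsupp.weight n u ∧ v.degree ≤ w.degree + 1

theorem DegreeLiftsAlong.isMaxDegree_single_add_iff {i : Fin d} (h : DegreeLiftsAlong n i)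
    {u : Fin d →₀ ℕ} : IsMaxDegree n (Finsupp.single i 1 + u) ↔ IsMaxDegree n u := by
  constructor
  · intro hu w hw
    have := hu (Finsupp.single i 1 + w) (by rw [map_add, map_add, hw])
    simpa using this
  · intro hu v hv
    obtain ⟨w, hw, hd⟩ := h u v (by rw [hv, map_add, weight_single_one, add_comm])
    have := hu w hw
    simp only [map_add, Finsupp.degree_single]
    omega

theorem DegreeLiftsAlong.maxDegreeMap_X_mul {i : Fin d} (h : DegreeLiftsAlong n i)
    (f : MvPolynomial (Fin d) K) :
    maxDegreeMap K n (X i * f) = Polynomial.X ^ n i * maxDegreeMap K n f := by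
  classical
  induction f using MvPolynomial.induction_on' with
  | add p q hp hq => simp only [mul_add, map_add, hp, hq]
  | monomial u c =>
    rw [X, monomial_mul, one_mul, maxDegreeMap_monomial, maxDegreeMap_monomial,
      h.isMaxDegree_single_add_iff, map_add, weight_single_one]
    split_ifs
    · rw [Polynomial.X_pow_mul_monomial, add_comm]
    · simp

/-- Since `X i` acts as `t ^ n i`, a polynomial `q (X i)` acts as `q (t ^ n i)`. General `q` are
needed to reach the maximal ideals away from the origin. -/
theorem DegreeLiftsAlong.maxDegreeMap_aeval_mul {i : Fin d} (h : DegreeLiftsAlong n i)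
    (q : Polynomial K) (f : MvPolynomial (Fin d) K) :
    maxDegreeMap K n (Polynomial.aeval (X i) q * f) =
      Polynomial.expand K (n i) q * maxDegreeMap K n f := by
  induction q using Polynomial.induction_on' with
  | add p q hp hq => simp only [add_mul, map_add, hp, hq]
  | monomial k c =>
    have hk : ∀ k : ℕ, maxDegreeMap K n (X i ^ k * f) =
        Polynomial.X ^ (k * n i) * maxDegreeMap K n f := by
      intro k
      induction k with
      | zero => simp
      | succ k ih => rw [pow_succ', mul_assoc, h.maxDegreeMap_X_mul, ih]; ring
    rw [Polynomial.aeval_monomial, Polynomial.expand_monomial, ← Polynomial.C_mul_X_pow_eq_monomial,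
      mul_assoc, mul_assoc, ← hk, MvPolynomial.algebraMap_eq, ← MvPolynomial.smul_eq_C_mul,
      map_smul, Polynomial.smul_eq_C_mul]

theorem DegreeLiftsAlong.mem_of_aeval_mul_mem (hn : ∀ i, 0 < n i) {i : Fin d}
    (h : DegreeLiftsAlong n i) {q : Polynomial K} (hq : q ≠ 0) {f : MvPolynomial (Fin d) K}
    (hf : Polynomial.aeval (X i) q * f ∈ initialFormIdeal (toricIdeal K n)) :
    f ∈ initialFormIdeal (toricIdeal K n) := by
  rw [mem_initialFormIdeal_iff] at hf ⊢
  rw [h.maxDegreeMap_aeval_mul] at hf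
  exact (mul_eq_zero.1 hf).resolve_left ((Polynomial.expand_ne_zero (hn i)).2 hq)

theorem degreeLiftsAlong_of_forall_mem (hn : ∀ i, 0 < n i) {i : Fin d}
    (h : ∀ w, IsMaxDegree n w → X i * monomial w (1 : K) ∉ initialFormIdeal (toricIdeal K n)) :
    DegreeLiftsAlong n i := by
  intro u v hv
  obtain ⟨w, hw, -, hm⟩ := exists_isMaxDegree hn u
  refine ⟨w, hw, ?_⟩
  by_contra hlt
  refine h w hm ?_
  rw [X, monomial_mul, one_mul]
  refine mem_initialFormIdeal_of_weight_eq (v := v) ?_ ?_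
  · rw [map_add, weight_single_one, hv, hw, add_comm]
  · simp only [map_add, Finsupp.degree_single]
    omega

/-- Nonconstant monomials strictly raise the weight. Hence anything that annihilates a
maximal-degree monomial in the tangent cone has zero constant term. -/
theorem coeff_maxDegreeMap_mul_monomial (hn : ∀ i, 0 < n i) {w : Fin d →₀ ℕ}
    (hw : IsMaxDegree n w) (f : MvPolynomial (Fin d) K) :
    (maxDegreeMap K n (f * monomial w 1)).coeff (Finsupp.weight n w) = constantCoeff f := by
  classical
  induction f using MvPolynomial.induction_on' with
  | add p q hp hq => simp only [add_mul, map_add, Polynomial.coeff_add, hp, hq]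
  | monomial u c =>
    rw [monomial_mul, mul_one, maxDegreeMap_monomial, constantCoeff_monomial]
    by_cases hu : u = 0
    · simp [hu, hw]
    · have : Finsupp.weight n u ≠ 0 := by
        obtain ⟨i, hi⟩ := Finsupp.ne_iff.1 hu
        rw [Finsupp.weight_eq_sum]
        intro h0
        have := Finset.sum_eq_zero_iff.1 h0 i (Finset.mem_univ i)
        rcases Nat.mul_eq_zero.1 this with h | h
        · exact hi h
        · exact (hn i).ne' h
      rw [if_neg hu]
      split_ifs
      · rw [Polynomial.coeff_monomial, if_neg]
        rw [map_add]
        omega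
      · simp

/-- A power of a variable of the least weight is the only element of largest degree in its
fibre. -/
theorem coeff_maxDegreeMap_of_forall_lt {i : Fin d} (hn : 0 < n i) (hi : ∀ j ≠ i, n i < n j)
    (f : MvPolynomial (Fin d) K) (k : ℕ) :
    (maxDegreeMap K n f).coeff (k * n i) = coeff (Finsupp.single i k) f := by
  classical
  have hmin : ∀ j, n i ≤ n j := fun j => by
    by_cases h : j = i
    · rw [h]
    · exact (hi j h).le
  have hwt : Finsupp.weight n (Finsupp.single i k) = k * n i := by
    rw [Finsupp.weight_single, smul_eq_mul]
  have hdeg : ∀ w : Fin d →₀ ℕ, w.degree * n i ≤ Finsupp.weight n w := by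
    intro w
    rw [Finsupp.degree_eq_sum, Finsupp.weight_eq_sum, Finset.sum_mul]
    exact Finset.sum_le_sum fun j _ => Nat.mul_le_mul_left _ (hmin j)
  have hmax : IsMaxDegree n (Finsupp.single i k) := by
    intro w hw
    rw [Finsupp.degree_single]
    exact Nat.le_of_mul_le_mul_right (by rw [← hwt, ← hw]; exact hdeg w) hn
  have huniq : ∀ w, IsMaxDegree n w → Finsupp.weight n w = k * n i → w = Finsupp.single i k := by
    intro w hw hwk
    have h1 : w.degree = k := by
      have h1 := hw _ (hwt.trans hwk.symm)
      have h2 := hmax w (hwk.trans hwt.symm)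
      rw [Finsupp.degree_single] at h1 h2
      omega
    -- Equality in `w.degree * n i ≤ weight w` forces equality term by term, hence `w j = 0`
    -- wherever `n i < n j`.
    have h2 : ∀ j ∈ Finset.univ, w j * n i = w j * n j := by
      refine (Finset.sum_eq_sum_iff_of_le fun j _ => Nat.mul_le_mul_left _ (hmin j)).1 ?_
      rw [← Finset.sum_mul, ← Finsupp.degree_eq_sum, h1, ← hwk, Finsupp.weight_eq_sum]
      rfl
    have h3 : ∀ j, j ≠ i → w j = 0 := by
      intro j hj
      by_contra h0
      exact (hi j hj).ne (Nat.eq_of_mul_eq_mul_left (Nat.pos_of_ne_zero h0)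
        (h2 j (Finset.mem_univ j)))
    have h4 : w i = k := by
      rw [← h1, Finsupp.degree_eq_sum, Finset.sum_eq_single i (fun j _ hj => h3 j hj) (by simp)]
    ext j
    by_cases hj : j = i
    · rw [hj, h4, Finsupp.single_eq_same]
    · rw [h3 j hj, Finsupp.single_eq_of_ne hj]
  induction f using MvPolynomial.induction_on' with
  | add p q hp hq => simp only [map_add, Polynomial.coeff_add, coeff_add, hp, hq]
  | monomial u c =>
    rw [maxDegreeMap_monomial, coeff_monomial]
    by_cases hu : u = Finsupp.single i k
    · rw [if_pos hu, hu, if_pos hmax, hwt, Polynomial.coeff_monomial, if_pos rfl]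
    · rw [if_neg hu]
      split_ifs with hm
      · rw [Polynomial.coeff_monomial, if_neg fun h => hu (huniq u hm h)]
      · rfl

end Toric

/-! ### Depth of local rings: the bound by dimension and positivity. -/

section Depth

variable {R : Type*} [CommRing R] [IsLocalRing R]

theorem localDepth_le_ringKrullDim [IsNoetherianRing R] : localDepth R ≤ ringKrullDim R := by
  refine iSup₂_le fun rs hrs => ?_
  have hreg := hrs.2
  rw [← ringKrullDim_add_length_eq_ringKrullDim_of_isRegular rs hreg]
  have : Nontrivial (R ⧸ Ideal.ofList rs) := by
    refine Ideal.Quotient.nontrivial_iff.2 fun h => hreg.top_ne_smul ?_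
    rw [h]
    simp
  exact le_add_of_nonneg_left ringKrullDim_nonneg_of_nontrivial

theorem one_le_localDepth_iff [IsNoetherianRing R] :
    1 ≤ localDepth R ↔ ∃ r ∈ IsLocalRing.maximalIdeal R, IsSMulRegular R r := by
  constructor
  · intro h
    by_contra! hne
    have : localDepth R ≤ 0 := by
      refine iSup₂_le fun rs hrs => ?_
      rcases rs with - | ⟨r, rs⟩
      · simp
      · exact absurd ((RingTheory.Sequence.isWeaklyRegular_cons_iff R r rs).1
          hrs.2.toIsWeaklyRegular).1 (hne r (hrs.1 r (by simp)))
    exact absurd (h.trans this) (by decide)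
  · rintro ⟨r, hr, hreg⟩
    have hmem : ∀ s ∈ [r], s ∈ IsLocalRing.maximalIdeal R := by simpa using hr
    refine le_iSup₂_of_le [r] ⟨hmem, ?_⟩ (by simp)
    rw [IsLocalRing.isRegular_iff_isWeaklyRegular_of_subset_maximalIdeal hmem,
      RingTheory.Sequence.isWeaklyRegular_singleton_iff]
    exact hreg

end Depth

/-! ### The tangent cone as a thickened line. -/

section TangentCone

variable {K : Type*} [Field K] {d : ℕ} {n : Fin d → ℕ} {i : Fin d}

open Classical in
variable (K) in
/-- Restriction of polynomials to the `i`-th coordinate axis. -/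
def axisMap (i : Fin d) : MvPolynomial (Fin d) K →ₐ[K] Polynomial K :=
  aeval fun j => if j = i then Polynomial.X else 0

theorem coeff_axisMap (f : MvPolynomial (Fin d) K) (k : ℕ) :
    (axisMap K i f).coeff k = coeff (Finsupp.single i k) f := by
  classical
  induction f using MvPolynomial.induction_on' with
  | add p q hp hq => rw [map_add, Polynomial.coeff_add, coeff_add, hp, hq]
  | monomial u c =>
    rw [axisMap, aeval_monomial, coeff_monomial, Polynomial.algebraMap_eq, Polynomial.coeff_C_mul]
    by_cases hu : ∃ l, u = Finsupp.single i l
    · obtain ⟨l, rfl⟩ := hu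
      simp [Polynomial.coeff_X_pow, (Finsupp.single_injective i).eq_iff, eq_comm]
    · have hj : ∃ j, j ≠ i ∧ u j ≠ 0 := by
        by_contra! h
        refine hu ⟨u i, Finsupp.ext fun j => ?_⟩
        by_cases hj : j = i
        · rw [hj, Finsupp.single_eq_same]
        · rw [h j hj, Finsupp.single_eq_of_ne hj]
      obtain ⟨j, hji, hj⟩ := hj
      rw [Finsupp.prod, Finset.prod_eq_zero (Finsupp.mem_support_iff.2 hj) (by simp [hji, hj]),
        if_neg fun h => hu ⟨k, h⟩]
      simp

theorem axisMap_eq_zero (hn : 0 < n i) (hi : ∀ j ≠ i, n i < n j) {f : MvPolynomial (Fin d) K}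
    (hf : f ∈ initialFormIdeal (toricIdeal K n)) : axisMap K i f = 0 := by
  ext k
  rw [coeff_axisMap, ← coeff_maxDegreeMap_of_forall_lt hn hi, maxDegreeMap_eq_zero hf,
    Polynomial.coeff_zero, Polynomial.coeff_zero]

/-- `X j ^ n i` and `X i ^ n j` have equal weight, and the first has smaller degree. -/
theorem isNilpotent_mk_X (hi : ∀ j ≠ i, n i < n j) {j : Fin d} (hj : j ≠ i) :
    IsNilpotent (Ideal.Quotient.mk (initialFormIdeal (toricIdeal K n)) (X j)) := by
  refine ⟨n i, ?_⟩
  rw [← map_pow, Ideal.Quotient.eq_zero_iff_mem, X_pow_eq_monomial]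
  refine mem_initialFormIdeal_of_weight_eq (v := Finsupp.single i (n j)) ?_ ?_
  · simp [Finsupp.weight_single, mul_comm]
  · simpa using hi j hj

theorem mk_sub_aeval_axisMap_mem_nilradical (hi : ∀ j ≠ i, n i < n j)
    (f : MvPolynomial (Fin d) K) :
    Ideal.Quotient.mk (initialFormIdeal (toricIdeal K n))
      (f - Polynomial.aeval (X i) (axisMap K i f)) ∈ nilradical (TangentConeRing K n) := by
  classical
  induction f using MvPolynomial.induction_on with
  | C a => simp [axisMap, ← MvPolynomial.algebraMap_eq]
  | add p q hp hq =>
    rw [map_add, map_add, add_sub_add_comm, map_add]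
    exact Ideal.add_mem _ hp hq
  | mul_X p j hp =>
    by_cases hj : j = i
    · have : axisMap K i (X j) = Polynomial.X := by simp [axisMap, hj]
      rw [map_mul, this, map_mul, Polynomial.aeval_X, hj, ← sub_mul, map_mul]
      exact Ideal.mul_mem_right _ _ hp
    · have : axisMap K i (X j) = 0 := by simp [axisMap, hj]
      rw [map_mul, this, mul_zero, map_zero, sub_zero, map_mul]
      exact Ideal.mul_mem_left _ _ (mem_nilradical.2 (isNilpotent_mk_X hi hj))

/-- Restriction of functions on the tangent cone to the `i`-th coordinate axis. -/
def tangentConeAxisMap (hn : 0 < n i) (hi : ∀ j ≠ i, n i < n j) :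
    TangentConeRing K n →ₐ[K] Polynomial K :=
  Ideal.Quotient.liftₐ _ (axisMap K i) fun _ hf => axisMap_eq_zero hn hi hf

theorem axisMap_aeval (q : Polynomial K) : axisMap K i (Polynomial.aeval (X i) q) = q := by
  rw [← Polynomial.aeval_algHom_apply]
  simp [axisMap]

/-- Restriction to the axis is onto `K[t]` with nilpotent kernel, hence a homeomorphism on spectra.
-/
theorem ringKrullDim_tangentConeRing_le (hn : 0 < n i) (hi : ∀ j ≠ i, n i < n j) :
    ringKrullDim (TangentConeRing K n) ≤ 1 := by
  have hsurj : Function.Surjective (tangentConeAxisMap (K := K) hn hi) := fun q =>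
    ⟨Ideal.Quotient.mk _ (Polynomial.aeval (X i) q), axisMap_aeval q⟩
  have hker : RingHom.ker (tangentConeAxisMap (K := K) hn hi).toRingHom ≤
      nilradical (TangentConeRing K n) := by
    intro a ha
    obtain ⟨f, rfl⟩ := Ideal.Quotient.mk_surjective a
    have h := mk_sub_aeval_axisMap_mem_nilradical hi f
    rwa [show axisMap K i f = 0 from ha, map_zero, sub_zero] at h
  have hh := PrimeSpectrum.isHomeomorph_comap (tangentConeAxisMap (K := K) hn hi).toRingHom
    (fun q => ⟨1, one_pos, by obtain ⟨a, ha⟩ := hsurj q; exact ⟨a, by simpa using ha⟩⟩) hker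
  rw [← PrimeSpectrum.topologicalKrullDim_eq_ringKrullDim, ← hh.topologicalKrullDim_eq,
    PrimeSpectrum.topologicalKrullDim_eq_ringKrullDim]
  exact (IsPrincipalIdealRing.ringKrullDim_eq_one _ (Polynomial.not_isField K)).le

/-- Otherwise `K[t]` would be isomorphic to the residue field of `m`. -/
theorem exists_aeval_mem_of_isMaximal (hi : ∀ j ≠ i, n i < n j)
    (m : Ideal (TangentConeRing K n)) [hm : m.IsMaximal] :
    ∃ q : Polynomial K, q ≠ 0 ∧ Ideal.Quotient.mk _ (Polynomial.aeval (X i) q) ∈ m := by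
  by_contra! hne
  let φ : Polynomial K →+* TangentConeRing K n ⧸ m :=
    (Ideal.Quotient.mk m).comp ((Ideal.Quotient.mk _).comp
      (Polynomial.aeval (X i : MvPolynomial (Fin d) K)).toRingHom)
  have hsurj : Function.Surjective φ := by
    intro a
    obtain ⟨a, rfl⟩ := Ideal.Quotient.mk_surjective a
    obtain ⟨f, rfl⟩ := Ideal.Quotient.mk_surjective a
    refine ⟨axisMap K i f, (Ideal.Quotient.eq.2 ?_).symm⟩
    have h := mk_sub_aeval_axisMap_mem_nilradical hi f
    rw [map_sub] at h
    exact (nilradical_le_prime m) h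
  have hker : RingHom.ker φ = ⊥ := by
    refine (Submodule.eq_bot_iff _).2 fun q hq => ?_
    by_contra hq0
    exact hne q hq0 (Ideal.Quotient.eq_zero_iff_mem.1 hq)
  let := Ideal.Quotient.field m
  have hmax := RingHom.ker_isMaximal_of_surjective φ hsurj
  rw [hker] at hmax
  exact Polynomial.not_isField K (Ring.isField_iff_maximal_bot.2 hmax)

/-- Local dimensions are at most one, so one regular element in each maximal ideal suffices; a
nonzero `q (X i)` serves. -/
theorem DegreeLiftsAlong.hasCohenMacaulayTangentCone (hn : ∀ j, 0 < n j)
    (hi : ∀ j ≠ i, n i < n j) (h : DegreeLiftsAlong n i) : HasCohenMacaulayTangentCone K n := by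
  refine ⟨inferInstance, fun m hm => ⟨inferInstance, localDepth_le_ringKrullDim.antisymm ?_⟩⟩
  have hdim : ringKrullDim (Localization.AtPrime m) ≤ 1 :=
    (IsLocalization.AtPrime.ringKrullDim_eq_height m (Localization.AtPrime m)).le.trans <|
      (Ideal.height_le_ringKrullDim_of_isPrime).trans
      (ringKrullDim_tangentConeRing_le (hn i) hi)
  refine hdim.trans (one_le_localDepth_iff.2 ?_)
  obtain ⟨q, hq, hqm⟩ := exists_aeval_mem_of_isMaximal hi m
  refine ⟨algebraMap _ _ (Ideal.Quotient.mk _ (Polynomial.aeval (X i) q)),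
    (IsLocalization.AtPrime.to_map_mem_maximal_iff _ m _).2 hqm, ?_⟩
  refine IsSMulRegular.of_right_eq_zero_of_smul fun z hz => ?_
  obtain ⟨a, s, rfl⟩ := IsLocalization.exists_mk'_eq m.primeCompl z
  rw [smul_eq_mul, ← IsLocalization.mk'_one (M := m.primeCompl), ← IsLocalization.mk'_mul,
    IsLocalization.mk'_eq_zero_iff] at hz
  obtain ⟨t, ht⟩ := hz
  refine (IsLocalization.mk'_eq_zero_iff _ _).2 ⟨t, ?_⟩
  obtain ⟨f, hf⟩ := Ideal.Quotient.mk_surjective ((t : TangentConeRing K n) * a)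
  rw [mul_left_comm, ← hf, ← map_mul, Ideal.Quotient.eq_zero_iff_mem] at ht
  rw [← hf, Ideal.Quotient.eq_zero_iff_mem]
  exact h.mem_of_aeval_mul_mem hn hq ht

/-- At the origin the depth is at least one, and the maximal ideal is contained in the radical of
`(x)`. A power of a regular element is thus a multiple of `x`, so `x` is regular there and cannot
annihilate a maximal-degree monomial. -/
theorem degreeLiftsAlong_of_hasCohenMacaulayTangentCone (hn : ∀ j, 0 < n j)
    (hi : ∀ j ≠ i, n i < n j) (h : HasCohenMacaulayTangentCone K n) : DegreeLiftsAlong n i := by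
  have hconst : ∀ f : MvPolynomial (Fin d) K, (axisMap K i f).coeff 0 = constantCoeff f := by
    intro f
    rw [coeff_axisMap, Finsupp.single_zero, constantCoeff_eq]
  let π : TangentConeRing K n →+* K :=
    Ideal.Quotient.lift _ constantCoeff fun f hf => by
      rw [← hconst, axisMap_eq_zero (hn i) hi hf, Polynomial.coeff_zero]
  have hπ : ∀ f, π (Ideal.Quotient.mk _ f) = constantCoeff f := fun f => rfl
  have hπs : Function.Surjective π := fun c => ⟨Ideal.Quotient.mk _ (C c), by simp [hπ]⟩
  let m : Ideal (TangentConeRing K n) := RingHom.ker π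
  have hm : m.IsMaximal := RingHom.ker_isMaximal_of_surjective π hπs
  set x : TangentConeRing K n := Ideal.Quotient.mk _ (X i) with hx
  have hrad : m ≤ (Ideal.span {x}).radical := by
    intro a ha
    obtain ⟨f, rfl⟩ := Ideal.Quotient.mk_surjective a
    have hf : constantCoeff f = 0 := ha
    rw [← sub_add_cancel f (Polynomial.aeval (X i) (axisMap K i f)), map_add]
    refine Ideal.add_mem _ (Ideal.radical_mono bot_le
      (mk_sub_aeval_axisMap_mem_nilradical hi f)) (Ideal.le_radical ?_)
    obtain ⟨q, hq⟩ := Polynomial.X_dvd_iff.2 ((hconst f).trans hf)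
    rw [hq, map_mul, Polynomial.aeval_X, map_mul]
    exact Ideal.mul_mem_right _ _ (Ideal.mem_span_singleton_self _)
  have hdim : 1 ≤ ringKrullDim (Localization.AtPrime m) := by
    refine le_trans ?_ (IsLocalization.AtPrime.ringKrullDim_eq_height m (Localization.AtPrime m)).ge
    -- A prime strictly below `m`, which gives `m` height at least one.
    let P : Ideal (TangentConeRing K n) :=
      RingHom.ker (tangentConeAxisMap (K := K) (hn i) hi).toRingHom
    have hP : P.IsPrime := RingHom.ker_isPrime _
    have hlt : P < m := by
      refine lt_of_le_of_ne (fun a ha => ?_) fun heq => ?_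
      · obtain ⟨f, rfl⟩ := Ideal.Quotient.mk_surjective a
        change constantCoeff f = 0
        rw [← hconst, show axisMap K i f = 0 from ha, Polynomial.coeff_zero]
      · have hxm : x ∈ m := by
          change constantCoeff (X i : MvPolynomial (Fin d) K) = 0
          simp
        rw [← heq] at hxm
        have : axisMap K i (X i) = 0 := hxm
        simp [axisMap] at this
    have := (le_add_self).trans (Ideal.height_add_one_le_of_lt_of_isPrime hlt)
    exact_mod_cast this
  obtain ⟨-, hCM⟩ := h.2 m
  have : IsNoetherianRing (Localization.AtPrime m) := (h.2 m).1
  obtain ⟨r, hrm, hr⟩ := one_le_localDepth_iff.1 (hdim.trans hCM.ge)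
  obtain ⟨N, hN⟩ : r ∈ (Ideal.span {algebraMap _ (Localization.AtPrime m) x}).radical := by
    rw [← Localization.AtPrime.map_eq_maximalIdeal] at hrm
    refine (Ideal.map_le_iff_le_comap.2 fun a ha => ?_) hrm
    obtain ⟨N, hN⟩ := hrad ha
    refine ⟨N, ?_⟩
    rw [← map_pow, ← Set.image_singleton, ← Ideal.map_span]
    exact Ideal.mem_map_of_mem _ hN
  obtain ⟨y, hy⟩ := Ideal.mem_span_singleton'.1 hN
  refine degreeLiftsAlong_of_forall_mem (K := K) hn fun w hw hmem => ?_
  have h0 : algebraMap _ (Localization.AtPrime m)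
      (Ideal.Quotient.mk (initialFormIdeal (toricIdeal K n)) (monomial w 1)) = 0 := by
    refine (hr.pow N).right_eq_zero_of_smul ?_
    rw [smul_eq_mul, ← hy, mul_assoc, ← map_mul, hx, ← map_mul,
      Ideal.Quotient.eq_zero_iff_mem.2 hmem, map_zero, mul_zero]
  obtain ⟨⟨s, hs⟩, hs0⟩ := (IsLocalization.map_eq_zero_iff m.primeCompl _ _).1 h0
  obtain ⟨f, rfl⟩ := Ideal.Quotient.mk_surjective s
  refine hs ?_
  change constantCoeff f = 0
  rw [← map_mul, Ideal.Quotient.eq_zero_iff_mem] at hs0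
  rw [← coeff_maxDegreeMap_mul_monomial hn hw f, maxDegreeMap_eq_zero hs0, Polynomial.coeff_zero]

theorem hasCohenMacaulayTangentCone_iff (hn : ∀ j, 0 < n j) (hi : ∀ j ≠ i, n i < n j) :
    HasCohenMacaulayTangentCone K n ↔ DegreeLiftsAlong n i :=
  ⟨degreeLiftsAlong_of_hasCohenMacaulayTangentCone hn hi,
    fun h => h.hasCohenMacaulayTangentCone hn hi⟩

end TangentCone

/-! ### Combinatorics of the five binomials. -/

section FourVariables

/-- The exponent vector with the given four entries. -/
def exponentVector (p q r s : ℕ) : Fin 4 →₀ ℕ := Finsupp.equivFunOnFinite.symm ![p, q, r, s]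

theorem exponentVector_eta (u : Fin 4 →₀ ℕ) : exponentVector (u 0) (u 1) (u 2) (u 3) = u := by
  ext j
  fin_cases j <;> rfl

theorem degree_exponentVector (p q r s : ℕ) : (exponentVector p q r s).degree = p + q + r + s := by
  simp [Finsupp.degree_eq_sum, Fin.sum_univ_four, exponentVector]

theorem weight_exponentVector (n : Fin 4 → ℕ) (p q r s : ℕ) :
    Finsupp.weight n (exponentVector p q r s) = p * n 0 + q * n 1 + r * n 2 + s * n 3 := by
  simp [Finsupp.weight_eq_sum, Fin.sum_univ_four, exponentVector]

theorem monomial_exponentVector (K : Type*) [Field K] (p q r s : ℕ) :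
    monomial (exponentVector p q r s) (1 : K) = X 0 ^ p * X 1 ^ q * X 2 ^ r * X 3 ^ s := by
  rw [monomial_eq, C_1, one_mul, Finsupp.prod_fintype _ _ fun _ => pow_zero _, Fin.prod_univ_four]
  rfl

variable {K : Type*} [Field K] {n : Fin 4 → ℕ} {e : Exponents}

/-- The pairs of exponent vectors of the five binomials. -/
def binomialExponents (e : Exponents) (g h : Fin 4 →₀ ℕ) : Prop :=
  (g = exponentVector e.a1 0 0 0 ∧ h = exponentVector 0 0 e.a13 e.a14) ∨
  (g = exponentVector 0 e.a2 0 0 ∧ h = exponentVector e.a21 0 e.a23 0) ∨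
  (g = exponentVector 0 0 e.a3 0 ∧ h = exponentVector 0 e.a32 0 e.a34) ∨
  (g = exponentVector 0 0 0 e.a4 ∧ h = exponentVector e.a41 e.a42 0 0) ∨
  (g = exponentVector e.a21 0 0 e.a34 ∧ h = exponentVector 0 e.a42 e.a13 0)

theorem binomials_eq (K : Type*) [Field K] (e : Exponents) :
    binomials K e =
      {p | ∃ g h, binomialExponents e g h ∧ p = monomial g (1 : K) - monomial h 1} := by
  ext p
  simp only [binomials, Set.mem_insert_iff, Set.mem_singleton_iff, Set.mem_ofPred_eq,
    binomialExponents]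
  constructor
  · rintro (rfl | rfl | rfl | rfl | rfl)
    · exact ⟨_, _, .inl ⟨rfl, rfl⟩, by simp [monomial_exponentVector]⟩
    · exact ⟨_, _, .inr (.inl ⟨rfl, rfl⟩), by simp [monomial_exponentVector]⟩
    · exact ⟨_, _, .inr (.inr (.inl ⟨rfl, rfl⟩)), by simp [monomial_exponentVector]⟩
    · exact ⟨_, _, .inr (.inr (.inr (.inl ⟨rfl, rfl⟩))), by simp [monomial_exponentVector]⟩
    · exact ⟨_, _, .inr (.inr (.inr (.inr ⟨rfl, rfl⟩))), by simp [monomial_exponentVector]⟩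
  · rintro ⟨g, h, ⟨rfl, rfl⟩ | ⟨rfl, rfl⟩ | ⟨rfl, rfl⟩ | ⟨rfl, rfl⟩ | ⟨rfl, rfl⟩, rfl⟩ <;>
      simp [monomial_exponentVector]

namespace IsGivenByBinomials

theorem weight_eq (H : IsGivenByBinomials K n e) {g h : Fin 4 →₀ ℕ}
    (hgh : binomialExponents e g h) : Finsupp.weight n g = Finsupp.weight n h := by
  rw [← monomial_sub_monomial_mem_toricIdeal_iff (K := K), ← H.minimal.1, binomials_eq]
  exact Ideal.subset_span ⟨g, h, hgh, rfl⟩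

theorem weight_eq₁ (H : IsGivenByBinomials K n e) : e.a1 * n 0 = e.a13 * n 2 + e.a14 * n 3 := by
  simpa [weight_exponentVector] using H.weight_eq (.inl ⟨rfl, rfl⟩)

theorem weight_eq₂ (H : IsGivenByBinomials K n e) : e.a2 * n 1 = e.a21 * n 0 + e.a23 * n 2 := by
  simpa [weight_exponentVector] using H.weight_eq (.inr (.inl ⟨rfl, rfl⟩))

theorem weight_eq₃ (H : IsGivenByBinomials K n e) : e.a3 * n 2 = e.a32 * n 1 + e.a34 * n 3 := by
  simpa [weight_exponentVector] using H.weight_eq (.inr (.inr (.inl ⟨rfl, rfl⟩)))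

theorem weight_eq₄ (H : IsGivenByBinomials K n e) : e.a4 * n 3 = e.a41 * n 0 + e.a42 * n 1 := by
  simpa [weight_exponentVector] using H.weight_eq (.inr (.inr (.inr (.inl ⟨rfl, rfl⟩))))

theorem weight_eq₅ (H : IsGivenByBinomials K n e) :
    e.a21 * n 0 + e.a34 * n 3 = e.a42 * n 1 + e.a13 * n 2 := by
  simpa [weight_exponentVector] using H.weight_eq (.inr (.inr (.inr (.inr ⟨rfl, rfl⟩))))

/-- A property of quadruples of exponents invariant under the five binomials is constant on the
fibres of the weight. -/
theorem iff_of_weight_eq (H : IsGivenByBinomials K n e) (Q : ℕ → ℕ → ℕ → ℕ → Prop)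
    (h₁ : ∀ p q r s, Q (p + e.a1) q r s ↔ Q p q (r + e.a13) (s + e.a14))
    (h₂ : ∀ p q r s, Q p (q + e.a2) r s ↔ Q (p + e.a21) q (r + e.a23) s)
    (h₃ : ∀ p q r s, Q p q (r + e.a3) s ↔ Q p (q + e.a32) r (s + e.a34))
    (h₄ : ∀ p q r s, Q p q r (s + e.a4) ↔ Q (p + e.a41) (q + e.a42) r s)
    (h₅ : ∀ p q r s, Q (p + e.a21) q r (s + e.a34) ↔ Q p (q + e.a42) (r + e.a13) s)
    {p q r s p' q' r' s' : ℕ}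
    (hw : p * n 0 + q * n 1 + r * n 2 + s * n 3 = p' * n 0 + q' * n 1 + r' * n 2 + s' * n 3) :
    Q p q r s ↔ Q p' q' r' s' := by
  rw [← weight_exponentVector, ← weight_exponentVector] at hw
  refine MonomialCurve.iff_of_weight_eq (K := K) (r := binomialExponents e)
    (P := fun u => Q (u 0) (u 1) (u 2) (u 3)) ?_ ?_ hw
  · rw [← H.minimal.1, binomials_eq]
  · intro g h w hgh
    obtain ⟨rfl, rfl⟩ | ⟨rfl, rfl⟩ | ⟨rfl, rfl⟩ | ⟨rfl, rfl⟩ | ⟨rfl, rfl⟩ := hgh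
    · exact h₁ (w 0) (w 1) (w 2) (w 3)
    · exact h₂ (w 0) (w 1) (w 2) (w 3)
    · exact h₃ (w 0) (w 1) (w 2) (w 3)
    · exact h₄ (w 0) (w 1) (w 2) (w 3)
    · exact h₅ (w 0) (w 1) (w 2) (w 3)

/-- An exponent vector not divisible by any term of the five binomials is alone in its fibre. -/
theorem eq_of_weight_eq (H : IsGivenByBinomials K n e) {p q r s p' q' r' s' : ℕ}
    (h₁ : p < e.a1) (h₁' : r < e.a13 ∨ s < e.a14) (h₂ : q < e.a2) (h₂' : p < e.a21 ∨ r < e.a23)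
    (h₃ : r < e.a3) (h₃' : q < e.a32 ∨ s < e.a34) (h₄ : s < e.a4) (h₄' : p < e.a41 ∨ q < e.a42)
    (h₅ : p < e.a21 ∨ s < e.a34) (h₅' : q < e.a42 ∨ r < e.a13)
    (hw : p' * n 0 + q' * n 1 + r' * n 2 + s' * n 3 = p * n 0 + q * n 1 + r * n 2 + s * n 3) :
    p' = p ∧ q' = q ∧ r' = r ∧ s' = s := by
  -- Being this one vector is invariant: on either side of each binomial the predicate is false.
  refine (H.iff_of_weight_eq (fun x y z t => x = p ∧ y = q ∧ z = r ∧ t = s)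
    ?_ ?_ ?_ ?_ ?_ hw).2 ⟨rfl, rfl, rfl, rfl⟩ <;>
  · intro x y z t
    omega

/-- Summing the second, third and fifth relations leaves one between `n 1` and `n 2` only. A nonzero
discrepancy would put some `x_3 ^ k` with `0 < k < a3` in the fibre of a power of `x_2`, yet it is
alone in its fibre. -/
theorem a3_eq_and_a2_eq (H : IsGivenByBinomials K n e) (hpos : ∀ i, 0 < n i) :
    e.a3 = e.a13 + e.a23 ∧ e.a2 = e.a32 + e.a42 := by
  have w₂ := H.weight_eq₂
  have w₃ := H.weight_eq₃
  have w₅ := H.weight_eq₅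
  have ⟨b13, c13⟩ := H.a13
  have ⟨b14, c14⟩ := H.a14
  have ⟨b21, c21⟩ := H.a21
  have ⟨b23, c23⟩ := H.a23
  have ⟨b32, c32⟩ := H.a32
  have ⟨b34, c34⟩ := H.a34
  have ⟨b41, c41⟩ := H.a41
  have ⟨b42, c42⟩ := H.a42
  have hpure : ∀ k l, k < e.a3 → k * n 2 = l * n 1 → k = 0 := by
    intro k l hk hkl
    have := H.eq_of_weight_eq (p := 0) (q := 0) (r := k) (s := 0) (p' := 0) (q' := l) (r' := 0)
      (s' := 0) (by omega) (by omega) (by omega) (by omega) (by omega) (by omega) (by omega)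
      (by omega) (by omega) (by omega) (by linarith)
    omega
  have h1 := hpos 1
  have h2 := hpos 2
  have hw : (e.a13 + e.a23) * n 2 + (e.a32 + e.a42) * n 1 = e.a3 * n 2 + e.a2 * n 1 := by linarith
  have hr : e.a3 = e.a13 + e.a23 := by
    rcases lt_trichotomy e.a3 (e.a13 + e.a23) with h | h | h
    · obtain ⟨k, hk⟩ := Nat.exists_eq_add_of_lt h
      have hle : e.a32 + e.a42 ≤ e.a2 := by
        by_contra hlt
        nlinarith
      obtain ⟨l, hl⟩ := Nat.exists_eq_add_of_le hle
      rw [hk, hl] at hw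
      exact absurd (hpure (k + 1) l (by omega) (by linarith)) (by omega)
    · exact h
    · obtain ⟨k, hk⟩ := Nat.exists_eq_add_of_lt h
      have hle : e.a2 ≤ e.a32 + e.a42 := by
        by_contra hlt
        nlinarith
      obtain ⟨l, hl⟩ := Nat.exists_eq_add_of_le hle
      rw [hk, hl] at hw
      exact absurd (hpure (k + 1) l (by omega) (by linarith)) (by omega)
  refine ⟨hr, ?_⟩
  rw [hr] at hw
  exact (Nat.eq_of_mul_eq_mul_right h1 (Nat.add_left_cancel hw)).symm

/-- The same argument with the first, fourth and fifth relations, and powers of `x_4` and `x_1`. -/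
theorem a4_eq (H : IsGivenByBinomials K n e) (hpos : ∀ i, 0 < n i) :
    e.a4 = e.a14 + e.a34 := by
  have w₁ := H.weight_eq₁
  have w₄ := H.weight_eq₄
  have w₅ := H.weight_eq₅
  have ⟨b13, c13⟩ := H.a13
  have ⟨b14, c14⟩ := H.a14
  have ⟨b21, c21⟩ := H.a21
  have ⟨b23, c23⟩ := H.a23
  have ⟨b32, c32⟩ := H.a32
  have ⟨b34, c34⟩ := H.a34
  have ⟨b41, c41⟩ := H.a41
  have ⟨b42, c42⟩ := H.a42
  have hpure : ∀ k l, k < e.a4 → k * n 3 = l * n 0 → k = 0 := by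
    intro k l hk hkl
    have := H.eq_of_weight_eq (p := 0) (q := 0) (r := 0) (s := k) (p' := l) (q' := 0) (r' := 0)
      (s' := 0) (by omega) (by omega) (by omega) (by omega) (by omega) (by omega) (by omega)
      (by omega) (by omega) (by omega) (by linarith)
    omega
  have h0 := hpos 0
  have h3 := hpos 3
  have hw : (e.a14 + e.a34) * n 3 + (e.a21 + e.a41) * n 0 = e.a4 * n 3 + e.a1 * n 0 := by linarith
  rcases lt_trichotomy e.a4 (e.a14 + e.a34) with h | h | h
  · obtain ⟨k, hk⟩ := Nat.exists_eq_add_of_lt h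
    have hle : e.a21 + e.a41 ≤ e.a1 := by
      by_contra hlt
      nlinarith
    obtain ⟨l, hl⟩ := Nat.exists_eq_add_of_le hle
    rw [hk, hl] at hw
    exact absurd (hpure (k + 1) l (by omega) (by linarith)) (by omega)
  · exact h
  · obtain ⟨k, hk⟩ := Nat.exists_eq_add_of_lt h
    have hle : e.a1 ≤ e.a21 + e.a41 := by
      by_contra hlt
      nlinarith
    obtain ⟨l, hl⟩ := Nat.exists_eq_add_of_le hle
    rw [hk, hl] at hw
    exact absurd (hpure (k + 1) l (by omega) (by linarith)) (by omega)

end IsGivenByBinomials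

/-! ### Degree lifting along `x_1` and the three inequalities. -/

theorem degreeLiftsAlong_zero_iff : DegreeLiftsAlong n 0 ↔ ∀ p q r s p' q' r' s' : ℕ,
    p' * n 0 + q' * n 1 + r' * n 2 + s' * n 3 = p * n 0 + q * n 1 + r * n 2 + s * n 3 + n 0 →
    ∃ x y z t, x * n 0 + y * n 1 + z * n 2 + t * n 3 = p * n 0 + q * n 1 + r * n 2 + s * n 3 ∧
      p' + q' + r' + s' ≤ x + y + z + t + 1 := by
  constructor
  · intro h p q r s p' q' r' s' hw
    obtain ⟨w, hw, hd⟩ := h (exponentVector p q r s) (exponentVector p' q' r' s')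
      (by simpa only [weight_exponentVector] using hw)
    rw [← exponentVector_eta w] at hw hd
    simp only [weight_exponentVector, degree_exponentVector] at hw hd
    exact ⟨_, _, _, _, hw, hd⟩
  · intro h u v huv
    rw [← exponentVector_eta u, ← exponentVector_eta v] at huv
    simp only [weight_exponentVector] at huv
    obtain ⟨x, y, z, t, hw, hd⟩ := h _ _ _ _ _ _ _ _ huv
    refine ⟨exponentVector x y z t, ?_, ?_⟩
    · conv_rhs => rw [← exponentVector_eta u]
      simpa only [weight_exponentVector] using hw
    · conv_lhs => rw [← exponentVector_eta v]
      simpa only [degree_exponentVector] using hd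

theorem IsGivenByBinomials.degree_inequalities (H : IsGivenByBinomials K n e)
    (h1 : e.a32 < e.a42) (h2 : e.a14 ≤ e.a34) (h : DegreeLiftsAlong n 0) :
    e.a2 ≤ e.a21 + e.a23 ∧ e.a42 + e.a13 ≤ e.a21 + e.a34 ∧
      e.a3 + e.a13 + e.a14 ≤ e.a1 + e.a32 + e.a34 := by
  rw [degreeLiftsAlong_zero_iff] at h
  have w₁ := H.weight_eq₁
  have w₂ := H.weight_eq₂
  have w₃ := H.weight_eq₃
  have w₅ := H.weight_eq₅
  have ⟨b13, c13⟩ := H.a13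
  have ⟨b14, c14⟩ := H.a14
  have ⟨b21, c21⟩ := H.a21
  have ⟨b23, c23⟩ := H.a23
  have ⟨b32, c32⟩ := H.a32
  have ⟨b34, c34⟩ := H.a34
  have ⟨b41, c41⟩ := H.a41
  have ⟨b42, c42⟩ := H.a42
  obtain ⟨k, hk⟩ := Nat.exists_eq_add_of_lt b21
  obtain ⟨l, hl⟩ := Nat.exists_eq_add_of_lt (b21.trans c21)
  obtain ⟨m, hm⟩ := Nat.exists_eq_add_of_le h2
  rw [zero_add] at hk hl
  refine ⟨?_, ?_, ?_⟩
  -- The lifting is tested on `x_1 ^ a21 * x_3 ^ a23` with one `x_1` removed; that monomial is alone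
  -- in its fibre. The next case does the same for the fifth binomial.
  · obtain ⟨x, y, z, t, hw, hd⟩ := h k 0 e.a23 0 0 e.a2 0 0 (by rw [hk] at w₂; linarith)
    have := H.eq_of_weight_eq (by omega) (by omega) (by omega) (by omega) (by omega) (by omega)
      (by omega) (by omega) (by omega) (by omega) hw
    omega
  · obtain ⟨x, y, z, t, hw, hd⟩ := h k 0 0 e.a34 0 e.a42 e.a13 0 (by rw [hk] at w₅; linarith)
    have := H.eq_of_weight_eq (by omega) (by omega) (by omega) (by omega) (by omega) (by omega)
      (by omega) (by omega) (by omega) (by omega) hw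
    omega
  -- The third and first binomials give `x_3 ^ (a3 + a13)` the weight of `x_1 ^ a1 * x_2 ^ a32 * x_4
  -- ^ (a34 - a14)`. With one `x_1` removed, the latter is alone in its fibre thanks to `a32 < a42`.
  · obtain ⟨x, y, z, t, hw, hd⟩ := h l e.a32 0 m 0 0 (e.a3 + e.a13) 0
      (by rw [hl] at w₁; rw [hm] at w₃; linarith)
    have := H.eq_of_weight_eq (by omega) (by omega) (by omega) (by omega) (by omega) (by omega)
      (by omega) (by omega) (by omega) (by omega) hw
    omega

theorem IsGivenByBinomials.degreeLiftsAlong (H : IsGivenByBinomials K n e) (hpos : ∀ i, 0 < n i)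
    (hmono : StrictMono n) (h2 : e.a14 ≤ e.a34) (i₁ : e.a2 ≤ e.a21 + e.a23)
    (i₂ : e.a42 + e.a13 ≤ e.a21 + e.a34) (i₃ : e.a3 + e.a13 + e.a14 ≤ e.a1 + e.a32 + e.a34) :
    DegreeLiftsAlong n 0 := by
  have n01 : n 0 < n 1 := hmono (by decide)
  have n12 : n 1 < n 2 := hmono (by decide)
  have n23 : n 2 < n 3 := hmono (by decide)
  have w₁ := H.weight_eq₁
  have w₂ := H.weight_eq₂
  have w₃ := H.weight_eq₃
  have w₄ := H.weight_eq₄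
  have w₅ := H.weight_eq₅
  have ⟨b13, c13⟩ := H.a13
  have ⟨b14, c14⟩ := H.a14
  have ⟨b21, c21⟩ := H.a21
  have ⟨b23, c23⟩ := H.a23
  have ⟨b32, c32⟩ := H.a32
  have ⟨b34, c34⟩ := H.a34
  have ⟨b41, c41⟩ := H.a41
  have ⟨b42, c42⟩ := H.a42
  have e4 := H.a4_eq hpos
  obtain ⟨-, e2⟩ := H.a3_eq_and_a2_eq hpos
  have d₁ : e.a13 + e.a14 ≤ e.a1 := by
    refine Nat.le_of_mul_le_mul_right ?_ (hpos 0)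
    rw [w₁, add_mul]
    exact Nat.add_le_add (Nat.mul_le_mul_left _ (by omega)) (Nat.mul_le_mul_left _ (by omega))
  have d₄ : e.a4 ≤ e.a41 + e.a42 := by
    refine Nat.le_of_mul_le_mul_right ?_ (hpos 3)
    rw [w₄, add_mul]
    exact Nat.add_le_add (Nat.mul_le_mul_left _ (by omega)) (Nat.mul_le_mul_left _ (by omega))
  rw [degreeLiftsAlong_zero_iff]
  intro p q r s p' q' r' s' hw
  -- Divisibility by one of six monomials, each of the weight of a multiple of `x_1`. Only
  -- invariance under the third binomial is delicate: it uses `e2`, `e4` and `a14 ≤ a34`, and is why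
  -- `x_3 ^ (a3 + a13)` is listed.
  have hQ := H.iff_of_weight_eq
    (fun p q r s => 1 ≤ p ∨ (e.a13 ≤ r ∧ e.a14 ≤ s) ∨ e.a2 ≤ q ∨ e.a4 ≤ s ∨
      (e.a42 ≤ q ∧ e.a13 ≤ r) ∨ e.a3 + e.a13 ≤ r)
    (by intros; omega) (by intros; omega) (by intros; omega) (by intros; omega)
    (by intros; omega) (show p' * n 0 + q' * n 1 + r' * n 2 + s' * n 3 =
      (p + 1) * n 0 + q * n 1 + r * n 2 + s * n 3 by linarith)
  -- `k`, `l`, `m` are `a21 - 1`, `a1 - 1`, `a41 - 1`: the powers of `x_1` left once one factor is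
  -- removed.
  obtain ⟨k, hk⟩ := Nat.exists_eq_add_of_lt b21
  obtain ⟨l, hl⟩ := Nat.exists_eq_add_of_lt (b21.trans c21)
  obtain ⟨m, hm⟩ := Nat.exists_eq_add_of_lt b41
  obtain ⟨j, hj⟩ := Nat.exists_eq_add_of_le h2
  rw [zero_add] at hk hl hm
  rcases hQ.2 (.inl (by omega)) with h | ⟨h, h'⟩ | h | h | ⟨h, h'⟩ | h
  · obtain ⟨a, rfl⟩ := Nat.exists_eq_add_of_le h
    exact ⟨a, q', r', s', by linarith, by omega⟩
  · obtain ⟨a, rfl⟩ := Nat.exists_eq_add_of_le h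
    obtain ⟨b, rfl⟩ := Nat.exists_eq_add_of_le h'
    rw [hl] at w₁
    exact ⟨p' + l, q', a, b, by linarith, by omega⟩
  · obtain ⟨a, rfl⟩ := Nat.exists_eq_add_of_le h
    rw [hk] at w₂
    exact ⟨p' + k, a, r' + e.a23, s', by linarith, by omega⟩
  · obtain ⟨a, rfl⟩ := Nat.exists_eq_add_of_le h
    rw [hm] at w₄
    exact ⟨p' + m, q' + e.a42, r', a, by linarith, by omega⟩
  · obtain ⟨a, rfl⟩ := Nat.exists_eq_add_of_le h
    obtain ⟨b, rfl⟩ := Nat.exists_eq_add_of_le h'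
    rw [hk] at w₅
    exact ⟨p' + k, a, b, s' + e.a34, by linarith, by omega⟩
  · obtain ⟨a, rfl⟩ := Nat.exists_eq_add_of_le h
    rw [hl] at w₁
    rw [hj] at w₃
    exact ⟨p' + l, q' + e.a32, a, s' + j, by linarith, by omega⟩

end FourVariables

end MonomialCurve

end

theorem mainTheorem3 (K : Type*) [Field K] (n : Fin 4 → ℕ) (hpos : ∀ i, 0 < n i)
    (hmono : StrictMono n) (hgcd : Finset.univ.gcd n = 1)
    (e : MonomialCurve.Exponents) (hcase : MonomialCurve.IsGivenByBinomials K n e)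
    (h1 : e.a32 < e.a42) (h2 : e.a14 ≤ e.a34) :
    MonomialCurve.HasCohenMacaulayTangentCone K n ↔
      e.a2 ≤ e.a21 + e.a23 ∧
      e.a42 + e.a13 ≤ e.a21 + e.a34 ∧
      (e.a3 : ℤ) + e.a13 ≤ e.a1 + e.a32 + e.a34 - e.a14 := by
  rw [MonomialCurve.hasCohenMacaulayTangentCone_iff hpos (i := 0)
    fun j hj => hmono (Fin.pos_of_ne_zero hj)]
  constructor
  · intro h
    obtain ⟨i₁, i₂, i₃⟩ := hcase.degree_inequalities h1 h2 h
    exact ⟨i₁, i₂, by omega⟩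
  · rintro ⟨i₁, i₂, i₃⟩
    exact hcase.degreeLiftsAlong hpos hmono h2 i₁ i₂ (by omega)
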